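/- **Set-up.** Let $X$ be a path connected, unbounded smooth $k$-manifold smoothly embedded in $\mathbb R^{k+1}$, with the induced Riemannian metric, the associated Riemannian distance, length element $dx$ and volume $m=\mathrm{vol}$. Let $\mathbb Z$ act on $X$ by Riemannian isometries $\alpha_n$, and let $X=\coprod_{n\in\mathbb Z}F_n$ with $F_n=\alpha_n(F_0)$, where $F_0$ is measurable, of finite volume and finite diameter, and where the closures in $\mathbb R^{k+1}$ of $F_m$ and $F_n$ are disjoint whenever $|m-n|\ge 2$. Let $h_0:X\to[0,\infty)$ be smooth, let $x_0\in X$, and define $$h(x)=\pm\inf_\gamma\Big|\int_\gamma h_0\,dx\Big|,$$ the infimum being over $C^1$ paths $\gamma$ from $x_0$ to $x$, with sign $+$ if $x\in F_n$ with $n\ge 0$ and sign $-$ if $x\in F_n$ with $n<0$. Assume that $(X,h,\mathbb Z)$ is a triple: $h(F_0)\subseteq[0,1)$ and $h(\alpha_n(x))=h(x)+n+b(x,n)$ for all $x\in F_0$, $n\in\mathbb Z$, with $b$ bounded. Let $\varepsilon>0$. Let $U\subseteq F_0$ be open in $X$, connected, with smooth boundary, with $x_0\in U$, with the same diameter as $F_0$,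 and exhausting the volume of $F_0$ up to $\varepsilon$, i.e. $\mathrm{vol}(F_0\setminus U)\le\varepsilon$. Let $B\in\mathbb R$ and let $G'$ be a set of diffeomorphisms of $X$ commuting with the $\mathbb Z$-action such that for every $g\in G'$ the function $h_0$ is integrable on $g(F_0)$, $$\Big|\int_{g(F_0)}h_0\,dm\Big|\le B,$$ $$\varepsilon<\inf_{x\in \mathrm{Int}\,g(U)}\ \sup\big\{\mathrm{vol}(D)\ :\ D \text{ an open metric ball of } X,\ x\in D,\ \overline D\subseteq\overline{g(U)}\big\}.$$ Let $G$ be a group which is maximal, with respect to inclusion, among the groups contained in $G'$, and which contains the translations $\alpha_n$, $n\in\mathbb Z$. **Theorem.** There is a constant $C_0$, depending only on $h$ (with the data $X$, $(\alpha_n)$, $(F_n)$, $h_0$, $x_0$ that define it) and on $\varepsilon$, and not on $U$, $B$, $G'$, $G$, such that for every $g\in G$ there is $r\in\mathbb R$ with $h(g(U))\subseteq[r,r+C_0]$. Moreover $\mu(g)=h(g\cdot x_0)-h(x_0)$ is a quasimorphism on $G$, its homogenization $\mu^h(g)=\lim_{n\to\infty}\mu(g^n)/n$ exists for every $g\in G$,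 and $\mu^h$ is a nonzero homogeneous quasimorphism on $G$ (homogeneous: $\mu^h(g^n)=n\,\mu^h(g)$ for all $n\in\mathbb Z$). -/

import Mathlib

open Set Filter MeasureTheory Manifold Bundle
open scoped ContDiff Topology ENNReal

noncomputable section

namespace PeriodicHypersurface

/-- A real function on a group is a quasimorphism if it is additive up to a uniform error. -/
def IsQuasimorphism {G : Type*} [Group G] (μ : G → ℝ) : Prop :=
  ∃ D : ℝ, ∀ a b : G, |μ (a * b) - μ a - μ b| ≤ D

/-- `μh` is the homogenization of `μ`: the limits `lim μ (g ^ n) / n` exist and equal `μh g`. -/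
def IsHomogenization {G : Type*} [Group G] (μ μh : G → ℝ) : Prop :=
  ∀ g : G, Tendsto (fun n : ℕ => μ (g ^ n) / n) atTop (𝓝 (μh g))

/-- Homogeneity: `μ (g ^ n) = n μ (g)` for every integer `n`. -/
def IsHomogeneous {G : Type*} [Group G] (μ : G → ℝ) : Prop :=
  ∀ (g : G) (n : ℤ), μ (g ^ n) = n * μ g

section Smooth

variable {k : ℕ} {X : Type*} [TopologicalSpace X] [ChartedSpace (EuclideanSpace ℝ (Fin k)) X]

variable (k) in
/-- The permutation `g` of the manifold `X` is a smooth diffeomorphism. -/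
def IsDiffeo (g : Equiv.Perm X) : Prop :=
  ContMDiff (𝓡 k) (𝓡 k) ∞ (fun x => g x) ∧ ContMDiff (𝓡 k) (𝓡 k) ∞ (fun x => g.symm x)

variable (k) in
/-- Diffeomorphisms commuting with the `ℤ`-action generated by `τ`. -/
def equivariantDiffeos (τ : Equiv.Perm X) : Set (Equiv.Perm X) :=
  {g | IsDiffeo k g ∧ ∀ x, g (τ x) = τ (g x)}

variable (k) in
/-- An open set with smooth boundary: near each boundary point it is a sublevel set
`{f < 0}` of a smooth function with nonvanishing differential at that point. -/
def HasSmoothBoundary (U : Set X) : Prop :=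
  ∀ x ∈ frontier U, ∃ W : Set X, IsOpen W ∧ x ∈ W ∧ ∃ f : X → ℝ,
    ContMDiffOn (𝓡 k) 𝓘(ℝ, ℝ) ∞ f W ∧ mfderiv (𝓡 k) 𝓘(ℝ, ℝ) f x ≠ 0 ∧
      U ∩ W = {y ∈ W | f y < 0}

end Smooth

section Riemannian

variable {k : ℕ} {X : Type*} [MetricSpace X] [ChartedSpace (EuclideanSpace ℝ (Fin k)) X]
  [RiemannianBundle (fun x : X => TangentSpace (𝓡 k) x)]

variable (k) in
/-- `∫_γ h₀ dx`, the integral of `h₀` along the `C¹` path `γ : [0,1] → X` with respect to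
the Riemannian length element. -/
def pathIntegral (h₀ : X → ℝ) (γ : ℝ → X) : ℝ :=
  ∫ t in (0 : ℝ)..1,
    h₀ (γ t) * ‖mfderivWithin 𝓘(ℝ, ℝ) (𝓡 k) γ (Icc (0 : ℝ) 1) t 1‖

variable (k) in
/-- `inf_γ |∫_γ h₀ dx|` over the `C¹` paths from `x₀` to `x`. -/
def pathInf (h₀ : X → ℝ) (x₀ x : X) : ℝ :=
  sInf {s : ℝ | ∃ γ : ℝ → X, ContMDiffOn 𝓘(ℝ, ℝ) (𝓡 k) 1 γ (Icc (0 : ℝ) 1) ∧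
    γ 0 = x₀ ∧ γ 1 = x ∧ s = |pathIntegral k h₀ γ|}

open Classical in
variable (k) in
/-- The height function `h = ± inf_γ |∫_γ h₀ dx|`, with the sign `+` on the domains `F n` with
`n ≥ 0` and the sign `-` on the domains `F n` with `n < 0`. -/
def height (F : ℤ → Set X) (h₀ : X → ℝ) (x₀ x : X) : ℝ :=
  if ∃ n : ℤ, 0 ≤ n ∧ x ∈ F n then pathInf k h₀ x₀ x else -pathInf k h₀ x₀ x

/-- The set-up for `X`: a path connected, unbounded smooth `k`-manifold embedded in `ℝ^(k+1)` by
`ι`, carrying the induced Riemannian metric, with an action of `ℤ` (generated by `τ`) by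
isometries, tiled by the fundamental domains `F n = τ ^ n (F 0)`, of finite volume and diameter,
whose closures in `ℝ^(k+1)` meet only for neighbouring indices. -/
structure IsPeriodic [MeasurableSpace X] [BorelSpace X]
    (ι : X → EuclideanSpace ℝ (Fin (k + 1))) (τ : Equiv.Perm X) (F : ℤ → Set X) : Prop where
  isEmbedding : Topology.IsEmbedding ι
  smooth : ContMDiff (𝓡 k) (𝓡 (k + 1)) ∞ ι
  induced_metric : ∀ (x : X) (v : TangentSpace (𝓡 k) x),
    ‖mfderiv (𝓡 k) (𝓡 (k + 1)) ι x v‖ = ‖v‖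
  pathConnected : PathConnectedSpace X
  unbounded : ¬ Bornology.IsBounded (univ : Set X)
  diffeo : IsDiffeo k τ
  isometry : Isometry τ
  translate : ∀ n : ℤ, (τ ^ n) '' F 0 = F n
  disjoint : Pairwise (fun m n => Disjoint (F m) (F n))
  cover : ⋃ n, F n = univ
  closures : ∀ m n : ℤ, (closure (ι '' F m) ∩ closure (ι '' F n)).Nonempty → |m - n| ≤ 1
  measurable : MeasurableSet (F 0)
  volume_finite : μHE[k] (F 0) < ⊤
  bounded : Bornology.IsBounded (F 0)

/-- `(X, h, ℤ)` is a triple (with `ρ = id`): `h (F 0) ⊆ [0, 1)` and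
`h (τ ^ n x) = h x + n + b (x, n)` for `x ∈ F 0`, with bounded `b`. -/
def IsTriple (h : X → ℝ) (τ : Equiv.Perm X) (F : ℤ → Set X) : Prop :=
  h '' F 0 ⊆ Ico 0 1 ∧
    ∃ b : X → ℤ → ℝ, (∃ M : ℝ, ∀ x ∈ F 0, ∀ n, |b x n| ≤ M) ∧
      ∀ x ∈ F 0, ∀ n : ℤ, h ((τ ^ n) x) = h x + n + b x n

variable (k) in
/-- The open set `U ⊆ F₀`: connected, with smooth boundary, of the same diameter as `F₀`, and
exhausting the volume of `F₀` up to the constant `ε`. -/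
structure IsCore [MeasurableSpace X] [BorelSpace X] (F₀ U : Set X) (ε : ℝ) : Prop where
  isOpen : IsOpen U
  connected : IsConnected U
  subset : U ⊆ F₀
  smoothBoundary : HasSmoothBoundary k U
  diam_eq : Metric.diam U = Metric.diam F₀
  volume_diff : μHE[k] (F₀ \ U) ≤ ENNReal.ofReal ε

variable (k) in
/-- The supremum of the volumes of the open balls containing `x` whose closure lies in the
closure of `V`. -/
def supBallVolume [MeasurableSpace X] [BorelSpace X] (V : Set X) (x : X) : ℝ≥0∞ :=
  sSup {v : ℝ≥0∞ | ∃ (y : X) (r : ℝ), x ∈ Metric.ball y r ∧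
    closure (Metric.ball y r) ⊆ closure V ∧ v = μHE[k] (Metric.ball y r)}

variable (k) in
/-- The two conditions on a map `g`: `|∫_{g(F₀)} h₀ dm| ≤ B`, and `ε` is less than the infimum
over `x ∈ Int g(U)` of the supremum of the volumes of the open balls through `x` in `g(U)`. -/
structure IsAdmissible [MeasurableSpace X] [BorelSpace X] (F₀ U : Set X) (h₀ : X → ℝ) (B ε : ℝ)
    (g : X → X) : Prop where
  integrable : IntegrableOn h₀ (g '' F₀) μHE[k]
  integral_le : |∫ x in g '' F₀, h₀ x ∂μHE[k]| ≤ B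
  ball_condition :
    ENNReal.ofReal ε < ⨅ x ∈ interior (g '' U), supBallVolume k (g '' U) x

end Riemannian

end PeriodicHypersurface

end

/-! By the triple condition, `h` agrees up to a bounded error `M` with the index of the tile
containing a point, so heights can be estimated by counting tiles. Bounded width: `g(U)` is open and
connected, and its translates are pairwise disjoint, hence its volume is at most that of `F 0`.
Since `U` has smooth boundary, it is the interior of its closure, so the ball condition covers
`g(U)` by balls inside it of volume greater than `ε`. Such balls have bounded radius, hence meet
boundedly many consecutive tiles. If `g(U)` met tiles of very distant indices, connectedness would
put it in all tiles between, and well-spaced tiles would give more disjoint balls than the volume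
allows (`exists_tile_range_le`). The bound involves neither `U` nor `g`. The metric input is that
bounded sets meet boundedly many tiles: tiles two indices apart are uniformly separated, and a path
cannot skip a tile. Quasimorphism: `b(U)` cannot lie in the translates of `F 0 \ U`, for its volume
would then be at most `ε`. So `b u = τ ^ n v` with `u, v ∈ U`, and by equivariance `a b u = τ ^ n (a
v)`. Bounded width lets `u` and `v` be replaced by `x₀`, so both `μ(ab) - μ(a)` and `μ(b)` are close
to `n`. The homogenization is nonzero because it equals `1` at `τ`. -/

namespace PeriodicHypersurface

/-! ### Quasimorphisms and their homogenization. -/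

section Quasimorphism

variable {G : Type*} [Group G] {μ : G → ℝ}

theorem IsQuasimorphism.abs_pow_sub_le {D : ℝ} (hD : ∀ a b : G, |μ (a * b) - μ a - μ b| ≤ D)
    (g : G) (n : ℕ) : |μ (g ^ n) - n * μ g| ≤ |μ 1| + n * D := by
  induction n with
  | zero => simp
  | succ n ih =>
    have h := hD (g ^ n) g
    rw [← pow_succ] at h
    push_cast
    rw [abs_le] at *
    constructor <;> linarith [h.1, h.2, ih.1, ih.2]

/-- The homogenization of a quasimorphism exists. -/
theorem IsQuasimorphism.exists_isHomogenization (hμ : IsQuasimorphism μ) :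
    ∃ μh : G → ℝ, IsHomogenization μ μh := by
  obtain ⟨D, hD⟩ := hμ
  have hD0 : 0 ≤ D := (abs_nonneg _).trans (hD 1 1)
  suffices H : ∀ g, ∃ l, Tendsto (fun n : ℕ => μ (g ^ n) / n) atTop (𝓝 l) by
    choose μh hμh using H
    exact ⟨μh, hμh⟩
  intro g
  -- Adding the defect makes the sequence subadditive, so Fekete's lemma applies; the extra `D / n`
  -- tends to zero.
  have hsub : Subadditive fun n : ℕ => μ (g ^ n) + D := fun m n => by
    have := (abs_le.1 (hD (g ^ m) (g ^ n))).2
    rw [← pow_add] at this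
    linarith
  have hbdd : BddBelow (range fun n : ℕ => (μ (g ^ n) + D) / n) := by
    refine ⟨-(|μ 1| + D + |μ g|), ?_⟩
    rintro _ ⟨n, rfl⟩
    rcases Nat.eq_zero_or_pos n with rfl | hn
    · simp only [CharP.cast_eq_zero, div_zero]
      have := abs_nonneg (μ 1)
      have := abs_nonneg (μ g)
      linarith
    · have hn' : (1 : ℝ) ≤ n := by exact_mod_cast hn
      dsimp only
      rw [le_div_iff₀ (by linarith)]
      have h1 := (abs_le.1 (abs_pow_sub_le hD g n)).1
      have h2 := neg_abs_le (μ g)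
      have h3 := abs_nonneg (μ 1)
      nlinarith
  refine ⟨hsub.lim, ?_⟩
  have h2 : Tendsto (fun n : ℕ => D / (n : ℝ)) atTop (𝓝 0) := tendsto_const_div_atTop_nhds_zero_nat D
  have h3 := (hsub.tendsto_lim hbdd).sub h2
  rw [sub_zero] at h3
  refine h3.congr fun n => ?_
  rw [add_div, add_sub_cancel_right]

/-- Dividing `abs_pow_sub_le` by `n` and passing to the limit keeps `μh` within `D` of `μ`; three
such errors and the defect of `μ` give `4 * D`. -/
theorem IsHomogenization.isQuasimorphism {μh : G → ℝ} (h : IsHomogenization μ μh)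
    (hμ : IsQuasimorphism μ) : IsQuasimorphism μh := by
  obtain ⟨D, hD⟩ := hμ
  have key : ∀ g, |μh g - μ g| ≤ D := fun g => by
    have h1 : Tendsto (fun n : ℕ => |μ (g ^ n) / n - μ g|) atTop (𝓝 |μh g - μ g|) :=
      ((h g).sub_const _).abs
    have h2 : Tendsto (fun n : ℕ => |μ 1| / (n : ℝ) + D) atTop (𝓝 (0 + D)) :=
      (tendsto_const_div_atTop_nhds_zero_nat _).add_const _
    rw [zero_add] at h2
    refine le_of_tendsto_of_tendsto h1 h2 ?_
    filter_upwards [eventually_gt_atTop 0] with n hn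
    have hn' : (0 : ℝ) < n := by exact_mod_cast hn
    have e1 : μ (g ^ n) / n - μ g = (μ (g ^ n) - n * μ g) / n := by field_simp
    have e2 : |μ 1| / (n : ℝ) + D = (|μ 1| + n * D) / n := by field_simp
    rw [e1, e2, abs_div, abs_of_pos hn']
    gcongr
    exact IsQuasimorphism.abs_pow_sub_le hD g n
  refine ⟨4 * D, fun a b => ?_⟩
  have h0 := hD a b
  have h1 := key a
  have h2 := key b
  have h3 := key (a * b)
  rw [abs_le] at *
  constructor <;> linarith [h0.1, h0.2, h1.1, h1.2, h2.1, h2.2, h3.1, h3.2]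

theorem IsHomogenization.map_pow {μh : G → ℝ} (h : IsHomogenization μ μh) (g : G) (k : ℕ) :
    μh (g ^ k) = k * μh g := by
  rcases Nat.eq_zero_or_pos k with rfl | hk
  · simp only [pow_zero, CharP.cast_eq_zero, zero_mul]
    refine tendsto_nhds_unique (h 1) ?_
    simpa using tendsto_const_div_atTop_nhds_zero_nat (μ 1)
  · have h1 : Tendsto (fun n : ℕ => k * n) atTop atTop := tendsto_id.const_mul_atTop' hk
    have h2 := ((h g).comp h1).const_mul (k : ℝ)
    refine tendsto_nhds_unique (h (g ^ k)) (h2.congr fun n => ?_)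
    have hk' : (k : ℝ) ≠ 0 := by exact_mod_cast hk.ne'
    simp only [Function.comp, pow_mul, Nat.cast_mul]
    rw [mul_div_assoc', mul_div_mul_left _ _ hk']

/-- The sum `μ (g ^ n) + μ (g⁻¹ ^ n)` stays within `D` of `μ 1`, so it vanishes after division by
`n`. -/
theorem IsHomogenization.map_inv {μh : G → ℝ} (h : IsHomogenization μ μh)
    (hμ : IsQuasimorphism μ) (g : G) : μh g⁻¹ = -μh g := by
  obtain ⟨D, hD⟩ := hμ
  have h1 := (h g).add (h g⁻¹)
  have h2 : Tendsto (fun n : ℕ => μ (g ^ n) / n + μ (g⁻¹ ^ n) / n) atTop (𝓝 0) := by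
    refine squeeze_zero_norm (fun n => ?_)
      (tendsto_const_div_atTop_nhds_zero_nat (|μ 1| + D))
    have h3 := hD (g ^ n) (g⁻¹ ^ n)
    rw [inv_pow, mul_inv_cancel] at h3
    rw [← add_div, Real.norm_eq_abs, abs_div, Nat.abs_cast, inv_pow]
    gcongr
    have h4 := neg_abs_le (μ 1)
    have h5 := le_abs_self (μ 1)
    rw [abs_le] at *
    constructor <;> linarith [h3.1, h3.2]
  linarith [tendsto_nhds_unique h1 h2]

/-- The homogenization of a quasimorphism is homogeneous. -/
theorem IsHomogenization.isHomogeneous {μh : G → ℝ} (h : IsHomogenization μ μh)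
    (hμ : IsQuasimorphism μ) : IsHomogeneous μh := by
  rintro g (n | n)
  · simpa using h.map_pow g n
  · rw [zpow_negSucc, h.map_inv hμ, h.map_pow, Int.cast_negSucc, neg_mul]

end Quasimorphism

/-! ### Connectedness and volume in a tiling. -/

/-- A preconnected set which meets the tiles of index `a` and `b` of a locally finite tiling,
tiles being adjacent only if their indices are, meets the tiles of intermediate index. -/
theorem inter_tile_nonempty {Y : Type*} [TopologicalSpace Y] {F : ℤ → Set Y} {S : Set Y}
    (hS : IsPreconnected S) (hcov : S ⊆ ⋃ n, F n) (hlf : LocallyFinite fun n => F n ∩ S)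
    (hF : ∀ m n : ℤ, (closure (F m) ∩ closure (F n)).Nonempty → |m - n| ≤ 1)
    {a m b : ℤ} (ham : a < m) (hmb : m < b) (ha : (S ∩ F a).Nonempty) (hb : (S ∩ F b).Nonempty) :
    (S ∩ F m).Nonempty := by
  by_contra hm
  rw [not_nonempty_iff_eq_empty] at hm
  -- If `S` missed tile `m`, the closed unions over `i < m` and `i > m` would cover it and so share
  -- a point, although indices on the two sides differ by at least `2`.
  have hcl : ∀ p : ℤ → Prop, IsClosed (⋃ i : {i // p i}, closure (F i ∩ S)) := fun p =>
    (hlf.comp_injective Subtype.val_injective).closure.isClosed_iUnion fun _ => isClosed_closure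
  obtain ⟨x, -, hx1, hx2⟩ := isPreconnected_closed_iff.1 hS _ _ (hcl (· < m)) (hcl (m < ·))
    (fun x hx => by
      obtain ⟨i, hi⟩ := mem_iUnion.1 (hcov hx)
      rcases lt_trichotomy i m with h | rfl | h
      · exact Or.inl (mem_iUnion.2 ⟨⟨i, h⟩, subset_closure ⟨hi, hx⟩⟩)
      · exact (eq_empty_iff_forall_notMem.1 hm x ⟨hx, hi⟩).elim
      · exact Or.inr (mem_iUnion.2 ⟨⟨i, h⟩, subset_closure ⟨hi, hx⟩⟩))
    (ha.mono fun x hx => ⟨hx.1, mem_iUnion.2 ⟨⟨a, ham⟩, subset_closure hx.symm⟩⟩)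
    (hb.mono fun x hx => ⟨hx.1, mem_iUnion.2 ⟨⟨b, hmb⟩, subset_closure hx.symm⟩⟩)
  obtain ⟨⟨i, hi⟩, hxi⟩ := mem_iUnion.1 hx1
  obtain ⟨⟨j, hj⟩, hxj⟩ := mem_iUnion.1 hx2
  have := hF i j ⟨x, closure_mono inter_subset_left hxi, closure_mono inter_subset_left hxj⟩
  rw [abs_le] at this
  omega

/-- The part covered by the translates of `T` of a set whose translates are pairwise disjoint has
at most the measure of `T`. -/
theorem measure_inter_iUnion_translates_le {X : Type*} [MeasurableSpace X] {μ : Measure X}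
    {τ : Equiv.Perm X} (hτ : ∀ (n : ℤ) (s : Set X), μ ((τ ^ n) '' s) = μ s) {S T : Set X}
    (hS : ∀ n : ℤ, MeasurableSet ((τ ^ n) '' S))
    (hdisj : Pairwise fun m n : ℤ => Disjoint ((τ ^ m) '' S) ((τ ^ n) '' S))
    (hT : MeasurableSet T) : μ (S ∩ ⋃ n : ℤ, (τ ^ n) '' T) ≤ μ T := by
  -- Each piece of `S` is moved back into `T`, where the pieces become disjoint.
  have h1 : ∀ n : ℤ, μ (S ∩ (τ ^ n) '' T) = μ ((τ ^ (-n)) '' S ∩ T) := fun n => by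
    rw [← hτ n ((τ ^ (-n)) '' S ∩ T), image_inter (τ ^ n).injective, ← image_comp,
      ← Equiv.Perm.coe_mul, ← zpow_add]
    simp
  calc μ (S ∩ ⋃ n : ℤ, (τ ^ n) '' T) ≤ ∑' n : ℤ, μ (S ∩ (τ ^ n) '' T) := by
        rw [inter_iUnion]; exact measure_iUnion_le _
    _ = ∑' n : ℤ, μ ((τ ^ (-n)) '' S ∩ T) := tsum_congr h1
    _ = μ (⋃ n : ℤ, (τ ^ (-n)) '' S ∩ T) := by
        refine (measure_iUnion (fun m n hmn => ?_) fun n => (hS _).inter hT).symm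
        exact (hdisj (neg_injective.ne hmn)).mono inter_subset_left inter_subset_left
    _ ≤ μ T := measure_mono (iUnion_subset fun _ => inter_subset_right)

/-! ### Open sets with smooth boundary. -/

section Smooth

variable {k : ℕ} {X : Type*} [TopologicalSpace X] [ChartedSpace (EuclideanSpace ℝ (Fin k)) X]

theorem mfderiv_eq_zero_of_isLocalMax {f : X → ℝ} {x : X} (h : IsLocalMax f x) :
    mfderiv (𝓡 k) 𝓘(ℝ, ℝ) f x = 0 := by
  by_cases hf : MDifferentiableAt (𝓡 k) 𝓘(ℝ, ℝ) f x
  · have : IsLocalMax (writtenInExtChartAt (𝓡 k) 𝓘(ℝ, ℝ) x f) (extChartAt (𝓡 k) x x) := by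
      have hc := (continuousAt_extChartAt_symm (I := 𝓡 k) x).tendsto
      rw [extChartAt_to_inv] at hc
      simpa only [IsLocalMax, IsMaxFilter, writtenInExtChartAt, extChartAt_model_space_eq_id,
        Function.comp, PartialEquiv.refl_coe, id, extChartAt_to_inv] using hc.eventually h
    rw [hf.mfderiv, ModelWithCorners.range_eq_univ, fderivWithin_univ]
    exact this.fderiv_eq_zero
  · exact mfderiv_zero_of_not_mdifferentiableAt hf

/-- An open set with smooth boundary is the interior of its closure. -/
theorem HasSmoothBoundary.interior_closure {U : Set X} (hU : IsOpen U)
    (h : HasSmoothBoundary k U) : interior (closure U) = U := by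
  refine Subset.antisymm (fun x hx => ?_) (interior_maximal subset_closure hU)
  by_contra hxU
  obtain ⟨W, hW, hxW, f, hf, hdf, hUW⟩ := h x ⟨interior_subset hx, by rwa [hU.interior_eq]⟩
  -- A boundary point interior to the closure would be a local maximum of the defining function,
  -- contradicting its nonzero differential.
  have hle : ∀ y ∈ W, y ∈ closure U → f y ≤ 0 := by
    intro y hyW hyU
    by_contra hy
    have hpos : W ∩ f ⁻¹' Ioi 0 ∈ 𝓝 y :=
      inter_mem (hW.mem_nhds hyW)
        ((hf.continuousOn.continuousAt (hW.mem_nhds hyW)) (Ioi_mem_nhds (not_le.1 hy)))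
    obtain ⟨z, ⟨hzW, hz⟩, hzU⟩ := mem_closure_iff_nhds.1 hyU _ hpos
    have h1 : z ∈ U ∩ W := ⟨hzU, hzW⟩
    rw [hUW] at h1
    exact absurd h1.2 (not_lt.2 (le_of_lt hz))
  have hge : 0 ≤ f x := by
    by_contra hlt
    have h1 : x ∈ {y ∈ W | f y < 0} := ⟨hxW, not_le.1 hlt⟩
    rw [← hUW] at h1
    exact hxU h1.1
  refine hdf (mfderiv_eq_zero_of_isLocalMax ?_)
  filter_upwards [hW.mem_nhds hxW, mem_interior_iff_mem_nhds.1 hx] with y hyW hyU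
  exact (hle y hyW hyU).trans hge

/-- A diffeomorphism, as a homeomorphism. -/
def IsDiffeo.homeomorph {g : Equiv.Perm X} (hg : IsDiffeo k g) : X ≃ₜ X where
  toEquiv := g
  continuous_toFun := hg.1.continuous
  continuous_invFun := hg.2.continuous

end Smooth

/-! ### Path integrals, lengths and distances. -/

section Riemannian

variable {k : ℕ} {X : Type*} [MetricSpace X]
    [ChartedSpace (EuclideanSpace ℝ (Fin k)) X]
    [RiemannianBundle (fun x : X => TangentSpace (𝓡 k) x)]

theorem abs_pathIntegral_le {h₀ : X → ℝ} {γ : ℝ → X} {K : ℝ}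
    (hK : ∀ t ∈ Icc (0 : ℝ) 1, |h₀ (γ t)| ≤ K) (hγ : pathELength (𝓡 k) γ 0 1 ≠ ⊤) :
    |pathIntegral k h₀ γ| ≤ K * (pathELength (𝓡 k) γ 0 1).toReal := by
  have hK0 : 0 ≤ K := (abs_nonneg _).trans (hK 0 (by simp))
  have h1 : ‖pathIntegral k h₀ γ‖ₑ ≤ ENNReal.ofReal K * pathELength (𝓡 k) γ 0 1 := by
    rw [pathIntegral, intervalIntegral.integral_of_le zero_le_one,
      pathELength_eq_lintegral_mfderivWithin_Icc, ← lintegral_const_mul' _ _ ENNReal.ofReal_ne_top,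
      ← integral_Icc_eq_integral_Ioc]
    refine (enorm_integral_le_lintegral_enorm _).trans
      (setLIntegral_mono' measurableSet_Icc fun t ht => ?_)
    rw [enorm_mul, enorm_norm]
    gcongr
    rw [← ofReal_norm]
    exact ENNReal.ofReal_le_ofReal (hK t ht)
  have h2 := ENNReal.toReal_mono (ENNReal.mul_ne_top ENNReal.ofReal_ne_top hγ) h1
  rwa [ENNReal.toReal_mul, ENNReal.toReal_ofReal hK0, toReal_enorm, Real.norm_eq_abs] at h2

theorem pathInf_nonneg (h₀ : X → ℝ) (x₀ x : X) : 0 ≤ pathInf k h₀ x₀ x := by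
  refine Real.sInf_nonneg ?_
  rintro _ ⟨γ, -, -, -, rfl⟩
  exact abs_nonneg _

theorem pathInf_le {h₀ : X → ℝ} {x₀ x : X} {γ : ℝ → X}
    (hγ : ContMDiffOn 𝓘(ℝ, ℝ) (𝓡 k) 1 γ (Icc (0 : ℝ) 1)) (h0 : γ 0 = x₀) (h1 : γ 1 = x) :
    pathInf k h₀ x₀ x ≤ |pathIntegral k h₀ γ| := by
  refine csInf_le ⟨0, ?_⟩ ⟨γ, hγ, h0, h1, rfl⟩
  rintro _ ⟨γ, -, -, -, rfl⟩
  exact abs_nonneg _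

theorem abs_height (F : ℤ → Set X) (h₀ : X → ℝ) (x₀ x : X) :
    |height k F h₀ x₀ x| = pathInf k h₀ x₀ x := by
  unfold height
  split_ifs
  · exact abs_of_nonneg (pathInf_nonneg _ _ _)
  · rw [abs_neg]; exact abs_of_nonneg (pathInf_nonneg _ _ _)

/-- The height is bounded along a `C¹` path of finite length. -/
theorem exists_abs_height_le_of_path (F : ℤ → Set X) {h₀ : X → ℝ} (hh₀ : Continuous h₀)
    {γ : ℝ → X} (hγ : ContMDiff 𝓘(ℝ, ℝ) (𝓡 k) 1 γ) (hlen : pathELength (𝓡 k) γ 0 1 ≠ ⊤) :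
    ∃ C : ℝ, ∀ t ∈ Icc (0 : ℝ) 1, |height k F h₀ (γ 0) (γ t)| ≤ C := by
  obtain ⟨K, hK⟩ := isCompact_Icc.exists_bound_of_continuousOn (s := Icc (0 : ℝ) 1)
    (hh₀.comp hγ.continuous).continuousOn
  refine ⟨K * (pathELength (𝓡 k) γ 0 1).toReal, fun t ht => ?_⟩
  have hlin : ContDiff ℝ 1 fun s : ℝ => t * s := contDiff_const.mul contDiff_id
  have hmono : Monotone fun s : ℝ => t * s := fun a b hab => mul_le_mul_of_nonneg_left hab ht.1
  have hK0 : 0 ≤ K := (norm_nonneg _).trans (hK 0 (by simp))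
  -- The initial segment of `γ` up to `t`, reparametrized on `[0, 1]`, is a competitor in the
  -- infimum defining the height at `γ t`.
  have hcomp : ContMDiff 𝓘(ℝ, ℝ) (𝓡 k) 1 (γ ∘ fun s => t * s) := hγ.comp hlin.contMDiff
  have hl : pathELength (𝓡 k) (γ ∘ fun s => t * s) 0 1 ≤ pathELength (𝓡 k) γ 0 1 := by
    rw [pathELength_comp_of_monotoneOn zero_le_one (hmono.monotoneOn _)
      (hlin.differentiable one_ne_zero).differentiableOn
      (hγ.mdifferentiable one_ne_zero).mdifferentiableOn]
    exact pathELength_mono (by simp) (by simpa using ht.2)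
  rw [abs_height]
  refine (pathInf_le hcomp.contMDiffOn (by simp) (by simp)).trans
    ((abs_pathIntegral_le (K := K) (fun s hs => ?_) (ne_top_of_le_ne_top hlen hl)).trans ?_)
  · exact hK _ ⟨mul_nonneg ht.1 hs.1, mul_le_one₀ ht.2 hs.1 hs.2⟩
  · exact mul_le_mul_of_nonneg_left (ENNReal.toReal_mono hlen hl) hK0

variable [IsRiemannianManifold (𝓡 k) X]

/-- A path of length close to the distance. -/
theorem exists_path_pathELength_lt {x y : X} {r : ℝ≥0∞} (hr : edist x y < r) :
    ∃ γ : ℝ → X, γ 0 = x ∧ γ 1 = y ∧ ContMDiff 𝓘(ℝ, ℝ) (𝓡 k) 1 γ ∧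
      pathELength (𝓡 k) γ 0 1 < r := by
  rw [IsRiemannianManifold.out (I := 𝓡 k) x y] at hr
  obtain ⟨γ, h0, h1, hγ, hl, -⟩ := exists_lt_locally_constant_of_riemannianEDist_lt hr zero_lt_one
  exact ⟨γ, h0, h1, hγ, hl⟩

theorem edist_le_pathELength {γ : ℝ → X} (hγ : ContMDiff 𝓘(ℝ, ℝ) (𝓡 k) 1 γ) {a b : ℝ}
    (hab : a ≤ b) : edist (γ a) (γ b) ≤ pathELength (𝓡 k) γ a b := by
  rw [IsRiemannianManifold.out (I := 𝓡 k)]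
  exact riemannianEDist_le_pathELength hγ.contMDiffOn rfl rfl hab

/-- A smooth map whose differentials are isometric does not increase distances. -/
theorem lipschitzWith_of_norm_mfderiv_eq {E : Type*} [NormedAddCommGroup E] [InnerProductSpace ℝ E]
    {ι : X → E} (hι : ContMDiff (𝓡 k) 𝓘(ℝ, E) 1 ι)
    (h : ∀ (x : X) (v : TangentSpace (𝓡 k) x), ‖mfderiv (𝓡 k) 𝓘(ℝ, E) ι x v‖ = ‖v‖) :
    LipschitzWith 1 ι := by
  intro x y
  rw [ENNReal.coe_one, one_mul]
  refine le_of_forall_gt fun r hr => ?_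
  obtain ⟨γ, rfl, rfl, hγ, hl⟩ := exists_path_pathELength_lt (k := k) hr
  refine lt_of_le_of_lt ?_ hl
  rw [IsRiemannianManifold.out (I := 𝓘(ℝ, E)) (ι (γ 0)) (ι (γ 1))]
  refine (riemannianEDist_le_pathELength (γ := ι ∘ γ) (hι.comp hγ).contMDiffOn rfl rfl
    zero_le_one).trans_eq ?_
  simp only [pathELength_eq_lintegral_mfderiv_Icc]
  refine lintegral_congr fun t => ?_
  rw [mfderiv_comp_apply t (hι.mdifferentiable one_ne_zero _) (hγ.mdifferentiable one_ne_zero _),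
    ← ofReal_norm, ← ofReal_norm]
  congr 1
  exact h _ _

end Riemannian

/-! ### Metric geometry of the tiles. -/

section Tiling

variable {k : ℕ} {X : Type*} [MetricSpace X]
    [ChartedSpace (EuclideanSpace ℝ (Fin k)) X]
    [RiemannianBundle (fun x : X => TangentSpace (𝓡 k) x)]
    [MeasurableSpace X] [BorelSpace X]
    {ι : X → EuclideanSpace ℝ (Fin (k + 1))} {τ : Equiv.Perm X} {F : ℤ → Set X}

namespace IsPeriodic

section Basic

variable (hX : IsPeriodic ι τ F)

include hX

theorem isometry_zpow (n : ℤ) : Isometry (τ ^ n : Equiv.Perm X) := by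
  have hinv : Isometry (τ⁻¹ : Equiv.Perm X) := hX.isometry.right_inv τ.apply_symm_apply
  have hpow : ∀ {σ : Equiv.Perm X}, Isometry σ → ∀ n : ℕ, Isometry (σ ^ n : Equiv.Perm X) := by
    intro σ hσ n
    induction n with
    | zero => exact isometry_id
    | succ n ih => rw [pow_succ]; exact ih.comp hσ
  rcases n with n | n
  · exact hpow hX.isometry n
  · rw [zpow_negSucc, ← inv_pow]
    exact hpow hinv _

theorem exists_mem_tile (x : X) : ∃ n, x ∈ F n := by
  rw [← mem_iUnion, hX.cover]; trivial

theorem zpow_apply_mem {n : ℤ} {x : X} (m : ℤ) (hx : x ∈ F n) : (τ ^ m) x ∈ F (m + n) := by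
  rw [← hX.translate n] at hx
  obtain ⟨y, hy, rfl⟩ := hx
  rw [← hX.translate (m + n), zpow_add]
  exact ⟨y, hy, rfl⟩

theorem zpow_neg_apply_mem {n : ℤ} {x : X} (hx : x ∈ F n) : (τ ^ (-n)) x ∈ F 0 := by
  simpa using hX.zpow_apply_mem (-n) hx

theorem dist_zpow (n : ℤ) (x y : X) : dist ((τ ^ n) x) ((τ ^ n) y) = dist x y :=
  (hX.isometry_zpow n).dist_eq x y

theorem measure_zpow_image (n : ℤ) (s : Set X) : μHE[k] ((τ ^ n) '' s) = μHE[k] s :=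
  (hX.isometry_zpow n).euclideanHausdorffMeasure_image s

theorem measure_tile (n : ℤ) : μHE[k] (F n) = μHE[k] (F 0) := by
  rw [← hX.translate n, hX.measure_zpow_image]

theorem measurableSet_zpow_image {s : Set X} (hs : MeasurableSet s) (n : ℤ) :
    MeasurableSet ((τ ^ n) '' s) := by
  rw [Equiv.image_eq_preimage_symm]
  have := (hX.isometry_zpow (-n)).continuous.measurable hs
  rwa [zpow_neg] at this

theorem measurableSet_tile (n : ℤ) : MeasurableSet (F n) := by
  rw [← hX.translate n]; exact hX.measurableSet_zpow_image hX.measurable n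

theorem abs_sub_le_one_of_closure_inter (m n : ℤ)
    (h : (closure (F m) ∩ closure (F n)).Nonempty) : |m - n| ≤ 1 := by
  obtain ⟨x, hm, hn⟩ := h
  have hc := hX.isEmbedding.continuous
  exact hX.closures m n ⟨ι x, image_closure_subset_closure_image hc ⟨x, hm, rfl⟩,
    image_closure_subset_closure_image hc ⟨x, hn, rfl⟩⟩

/-- This converts between heights and tile indices in all later estimates. -/
theorem abs_sub_le_of_isTriple {h : X → ℝ} (hT : IsTriple h τ F) :
    ∃ M : ℝ, ∀ n : ℤ, ∀ x ∈ F n, |h x - n| ≤ M := by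
  obtain ⟨h01, b, ⟨M, hM⟩, hb⟩ := hT
  refine ⟨1 + M, fun n x hx => ?_⟩
  rw [← hX.translate n] at hx
  obtain ⟨y, hy, rfl⟩ := hx
  have h1 := h01 ⟨y, hy, rfl⟩
  have h2 := hM y hy n
  rw [hb y hy n]
  rw [abs_le] at *
  constructor <;> linarith [h1.1, h1.2, h2.1, h2.2]

end Basic

variable [IsRiemannianManifold (𝓡 k) X]

/-- Tiles whose indices differ by `2` have a uniform positive distance. -/
theorem exists_pos_le_dist (hX : IsPeriodic ι τ F) :
    ∃ c : ℝ, 0 < c ∧ ∀ n : ℤ, ∀ x ∈ F n, ∀ y ∈ F (n + 2), c ≤ dist x y := by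
  have hlip : LipschitzWith 1 ι :=
    lipschitzWith_of_norm_mfderiv_eq (hX.smooth.of_le (by norm_cast))
      hX.induced_metric
  have hbdd : Bornology.IsBounded (F 2) := by
    rw [← hX.translate 2]
    exact (hX.isometry_zpow 2).lipschitz.isBounded_image hX.bounded
  have hc : ∀ {s : Set X}, Bornology.IsBounded s → IsCompact (closure (ι '' s)) := fun hs =>
    (hlip.isBounded_image hs).isCompact_closure
  have hdisj : Disjoint (closure (ι '' F 0)) (closure (ι '' F 2)) := by
    rw [disjoint_iff_inter_eq_empty, ← not_nonempty_iff_eq_empty]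
    intro hne
    have := hX.closures 0 2 hne
    norm_num at this
  -- The closure of the image of `F 0` is compact, hence at positive Euclidean distance from that of
  -- `F 2`. Intrinsic distances are at least as large, and translations carry the bound to every
  -- `n`.
  obtain ⟨r, hr, hr2⟩ := Metric.exists_pos_forall_lt_edist (hc hX.bounded) isClosed_closure hdisj
  refine ⟨r, hr, fun n x hx y hy => ?_⟩
  have hx' := hX.zpow_neg_apply_mem hx
  have hy' := hX.zpow_apply_mem (-n) hy
  rw [neg_add_cancel_left] at hy'
  rw [← hX.dist_zpow (-n)]
  have h1 := hlip.dist_le_mul ((τ ^ (-n)) x) ((τ ^ (-n)) y)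
  rw [NNReal.coe_one, one_mul] at h1
  refine le_trans ?_ h1
  have := hr2 _ (subset_closure ⟨_, hx', rfl⟩) _ (subset_closure ⟨_, hy', rfl⟩)
  rw [edist_nndist] at this
  exact_mod_cast this.le

/-- The tiles get far away from a point. -/
theorem exists_mul_le_dist (hX : IsPeriodic ι τ F) {h₀ : X → ℝ} (hh₀ : Continuous h₀) {x₀ : X}
    (hx₀ : x₀ ∈ F 0) (hT : IsTriple (height k F h₀ x₀) τ F) :
    ∃ c : ℝ, 0 < c ∧ ∀ (j : ℕ) (n : ℤ), 2 * (j : ℤ) ≤ |n| → ∀ x ∈ F n, c * j ≤ dist x₀ x := by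
  obtain ⟨c, hc, hcF⟩ := hX.exists_pos_le_dist
  obtain ⟨M, hM⟩ := hX.abs_sub_le_of_isTriple hT
  refine ⟨c, hc, fun j n hn x hx => ?_⟩
  suffices H : ENNReal.ofReal (c * j) ≤ edist x₀ x by
    rw [edist_dist] at H
    exact (ENNReal.ofReal_le_ofReal_iff dist_nonneg).1 H
  refine le_of_forall_gt fun r hr => ?_
  obtain ⟨γ, h0, h1, hγ, hl⟩ := exists_path_pathELength_lt (k := k) hr
  refine lt_of_le_of_lt ?_ hl
  subst h0
  obtain ⟨C, hC⟩ := exists_abs_height_le_of_path F hh₀ hγ (ne_top_of_lt hl)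
  have hcross : ∀ t ∈ Icc (0 : ℝ) 1, ∀ a m b : ℤ, a < m → m < b →
      (γ '' Icc 0 t ∩ F a).Nonempty → (γ '' Icc 0 t ∩ F b).Nonempty →
      (γ '' Icc 0 t ∩ F m).Nonempty := by
    intro t ht a m b ham hmb ha hb
    refine inter_tile_nonempty (isPreconnected_Icc.image _ hγ.continuous.continuousOn)
      (by rw [hX.cover]; exact subset_univ _) (fun x => ⟨univ, univ_mem, ?_⟩)
      hX.abs_sub_le_one_of_closure_inter ham hmb ha hb
    -- Local finiteness along the path: the height is at most `C` in absolute value there, and tile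
    -- indices differ from it by at most `M`.
    refine (finite_Icc (-⌈C + M⌉) ⌈C + M⌉).subset ?_
    rintro i ⟨_, ⟨hy, s, hs, rfl⟩, -⟩
    have e1 := hC s ⟨hs.1, hs.2.trans ht.2⟩
    have e2 := hM i _ hy
    rw [abs_le] at e1 e2
    have e3 := Int.le_ceil (C + M)
    constructor
    · have : (-⌈C + M⌉ : ℝ) ≤ i := by linarith [e1.1, e2.2]
      exact_mod_cast this
    · have : (i : ℝ) ≤ ⌈C + M⌉ := by linarith [e1.2, e2.1]
      exact_mod_cast this
  -- Stated for initial segments so that induction applies: before reaching `F n` the path visits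
  -- the tile two steps nearer to `F 0`, and the segment in between costs at least `c`.
  suffices H : ∀ (j : ℕ) (n : ℤ), 2 * (j : ℤ) ≤ |n| → ∀ t ∈ Icc (0 : ℝ) 1, γ t ∈ F n →
      ENNReal.ofReal (c * j) ≤ pathELength (𝓡 k) γ 0 t from
    H j n hn 1 (by simp) (h1 ▸ hx)
  clear hr hl h1 hx hn
  intro j
  induction j with
  | zero => simp
  | succ j ih =>
    intro n hn t ht htn
    have hstart : (γ '' Icc 0 t ∩ F 0).Nonempty := ⟨γ 0, ⟨0, ⟨le_rfl, ht.1⟩, rfl⟩, hx₀⟩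
    have hend : (γ '' Icc 0 t ∩ F n).Nonempty := ⟨γ t, ⟨t, ⟨ht.1, le_rfl⟩, rfl⟩, htn⟩
    obtain ⟨m, hm, hmn, hne⟩ : ∃ m : ℤ, 2 * (j : ℤ) ≤ |m| ∧ (n = m + 2 ∨ m = n + 2) ∧
        (γ '' Icc 0 t ∩ F m).Nonempty := by
      push_cast at hn
      rcases le_total 0 n with h | h
      · rw [abs_of_nonneg h] at hn
        refine ⟨n - 2, by rw [abs_of_nonneg] <;> omega, by omega, ?_⟩
        -- For `n = 2` the tile sought is `F 0` itself, which is not strictly between the ends but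
        -- contains the starting point.
        rcases eq_or_ne n 2 with rfl | h2
        · exact hstart
        · exact hcross t ht 0 (n - 2) n (by omega) (by omega) hstart hend
      · rw [abs_of_nonpos h] at hn
        refine ⟨n + 2, by rw [abs_of_nonpos] <;> omega, by omega, ?_⟩
        rcases eq_or_ne n (-2) with rfl | h2
        · exact hstart
        · exact hcross t ht n (n + 2) 0 (by omega) (by omega) hend hstart
    obtain ⟨_, ⟨s, hs, rfl⟩, hsm⟩ := hne
    have hd : c ≤ dist (γ s) (γ t) := by
      rcases hmn with rfl | rfl
      · exact hcF _ _ hsm _ htn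
      · rw [dist_comm]; exact hcF _ _ htn _ hsm
    rw [← pathELength_add hs.1 hs.2]
    push_cast
    rw [mul_add, mul_one, ENNReal.ofReal_add (by positivity) hc.le]
    refine add_le_add (ih m hm s ⟨hs.1, hs.2.trans ht.2⟩ hsm) ?_
    refine le_trans ?_ (edist_le_pathELength hγ hs.2)
    rw [edist_dist]
    exact ENNReal.ofReal_le_ofReal hd

/-- Bounded sets meet boundedly many tiles. -/
theorem exists_abs_sub_le_of_dist_le (hX : IsPeriodic ι τ F) {h₀ : X → ℝ} (hh₀ : Continuous h₀)
    {x₀ : X} (hx₀ : x₀ ∈ F 0) (hT : IsTriple (height k F h₀ x₀) τ F) (R : ℝ) :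
    ∃ K : ℕ, ∀ m n : ℤ, ∀ x ∈ F m, ∀ y ∈ F n, dist x y ≤ R → |m - n| ≤ K := by
  obtain ⟨c, hc, hcF⟩ := hX.exists_mul_le_dist hh₀ hx₀ hT
  obtain ⟨j, hj⟩ := exists_nat_gt ((Metric.diam (F 0) + R) / c)
  rw [div_lt_iff₀ hc] at hj
  -- After translation by `-m`, both points are within `diam (F 0) + R < c * j` of `x₀`.
  refine ⟨2 * j, fun m n x hx y hy hxy => ?_⟩
  by_contra! hlt
  have h1 := hX.zpow_apply_mem (-m) hy
  have h2 := hcF j (-m + n) (by rw [abs_sub_comm] at hlt; push_cast at hlt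
                                rw [neg_add_eq_sub]; exact hlt.le) _ h1
  have h3 := dist_triangle x₀ ((τ ^ (-m)) x) ((τ ^ (-m)) y)
  have h4 := Metric.dist_le_diam_of_mem hX.bounded hx₀ (hX.zpow_neg_apply_mem hx)
  rw [hX.dist_zpow] at h3
  linarith

theorem locallyFinite (hX : IsPeriodic ι τ F) {h₀ : X → ℝ} (hh₀ : Continuous h₀)
    {x₀ : X} (hx₀ : x₀ ∈ F 0) (hT : IsTriple (height k F h₀ x₀) τ F) : LocallyFinite F := by
  intro x
  obtain ⟨m, hm⟩ := hX.exists_mem_tile x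
  obtain ⟨K, hK⟩ := hX.exists_abs_sub_le_of_dist_le hh₀ hx₀ hT 1
  refine ⟨Metric.ball x 1, Metric.ball_mem_nhds _ one_pos,
    (finite_Icc (m - K) (m + K)).subset ?_⟩
  rintro n ⟨y, hyn, hy⟩
  have := hK m n x hm y hyn (by rw [dist_comm]; exact (Metric.mem_ball.1 hy).le)
  rw [abs_le] at this
  constructor <;> omega

omit [IsRiemannianManifold (𝓡 k) X] in
/-- A ball whose volume does not exceed that of a tile has bounded radius. -/
theorem radius_le (hX : IsPeriodic ι τ F) {x₀ : X} (hx₀ : x₀ ∈ F 0) (hpos : μHE[k] (F 0) ≠ 0)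
    {y : X} {r : ℝ} (hr : μHE[k] (Metric.ball y r) ≤ μHE[k] (F 0)) :
    r ≤ 2 * Metric.diam (F 0) + dist x₀ (τ x₀) := by
  -- A larger ball would contain both the tile of its centre and the next one, hence twice the
  -- finite positive volume of `F 0`.
  by_contra! hlt
  obtain ⟨n, hn⟩ := hX.exists_mem_tile y
  have hy := hX.zpow_neg_apply_mem hn
  have h0 := Metric.diam_nonneg (s := F 0)
  have h1 : F n ⊆ Metric.ball y r := fun z hz => by
    have := Metric.dist_le_diam_of_mem hX.bounded (hX.zpow_neg_apply_mem hz) hy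
    rw [hX.dist_zpow] at this
    rw [Metric.mem_ball]
    linarith [dist_nonneg (x := x₀) (y := τ x₀)]
  have h2 : F (n + 1) ⊆ Metric.ball y r := fun z hz => by
    have hz' : (τ ^ (-n)) z ∈ F 1 := by simpa using hX.zpow_apply_mem (-n) hz
    rw [← hX.translate 1] at hz'
    obtain ⟨w, hw, hwz⟩ := hz'
    rw [zpow_one] at hwz
    have e1 := Metric.dist_le_diam_of_mem hX.bounded hx₀ hw
    have e2 := Metric.dist_le_diam_of_mem hX.bounded hy hx₀
    have e3 := dist_triangle4 ((τ ^ (-n)) y) x₀ (τ x₀) (τ w)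
    rw [hX.isometry.dist_eq, hwz, hX.dist_zpow] at e3
    rw [Metric.mem_ball, dist_comm]
    linarith
  have h3 : μHE[k] (F n ∪ F (n + 1)) = μHE[k] (F 0) + μHE[k] (F 0) := by
    rw [measure_union (hX.disjoint (by omega)) (hX.measurableSet_tile _), hX.measure_tile,
      hX.measure_tile (n + 1)]
  have h4 := (measure_mono (union_subset h1 h2)).trans hr
  rw [h3] at h4
  exact absurd h4 (not_le.2 (ENNReal.lt_add_right hX.volume_finite.ne hpos))

/-- A connected open set with disjoint translates, which is a union of balls of volume greater than
`ε`, meets a bounded range of tiles. -/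
theorem exists_tile_range_le (hX : IsPeriodic ι τ F) {h₀ : X → ℝ} (hh₀ : Continuous h₀)
    {x₀ : X} (hx₀ : x₀ ∈ F 0) (hT : IsTriple (height k F h₀ x₀) τ F) {ε : ℝ} (hε : 0 < ε) :
    ∃ C : ℕ, ∀ S : Set X, IsOpen S → IsPreconnected S →
      (Pairwise fun m n : ℤ => Disjoint ((τ ^ m) '' S) ((τ ^ n) '' S)) →
      (∀ x ∈ S, ∃ y r, x ∈ Metric.ball y r ∧ Metric.ball y r ⊆ S ∧
        ENNReal.ofReal ε < μHE[k] (Metric.ball y r)) →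
      ∀ a b : ℤ, (S ∩ F a).Nonempty → (S ∩ F b).Nonempty → |a - b| ≤ C := by
  obtain ⟨K, hK⟩ := hX.exists_abs_sub_le_of_dist_le hh₀ hx₀ hT
    (2 * (2 * Metric.diam (F 0) + dist x₀ (τ x₀)))
  obtain ⟨N, hN⟩ := exists_nat_gt ((μHE[k] (F 0)).toReal / ε)
  rw [div_lt_iff₀ hε] at hN
  -- `K` bounds the index spread across one ball, so balls through tiles `2 * K + 1` apart are
  -- disjoint; `N` of them would have total volume above that of `F 0`.
  refine ⟨(2 * K + 1) * N, fun S hS hSc hdisj hball => ?_⟩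
  have hvol : μHE[k] S ≤ μHE[k] (F 0) := by
    have h1 := measure_inter_iUnion_translates_le hX.measure_zpow_image
      (hX.measurableSet_zpow_image hS.measurableSet) hdisj hX.measurable
    simp_rw [hX.translate, hX.cover, inter_univ] at h1
    exact h1
  have key : ∀ a b : ℤ, (S ∩ F a).Nonempty → (S ∩ F b).Nonempty → b - a ≤ (2 * K + 1) * N := by
    intro a b ha hb
    by_contra! hlt
    have hmeet : ∀ i : Fin N, (S ∩ F (a + (2 * K + 1) * (i : ℕ))).Nonempty := by
      intro i
      rcases Nat.eq_zero_or_pos i.val with h0 | h0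
      · simpa [h0] using ha
      · refine inter_tile_nonempty hSc (by rw [hX.cover]; exact subset_univ _)
          ((hX.locallyFinite hh₀ hx₀ hT).subset fun _ => inter_subset_left)
          hX.abs_sub_le_one_of_closure_inter ?_ ?_ ha hb
        · have : (0 : ℤ) < (2 * K + 1) * (i : ℕ) := by positivity
          omega
        · have : ((2 * K + 1) * (i : ℕ) : ℤ) ≤ (2 * K + 1) * N := by
            gcongr
            exact i.2.le
          omega
    choose x hx using hmeet
    choose y r hxy hyS hv using fun i => hball (x i) (hx i).1
    -- The radius bound needs `F 0` to have positive volume, which any one of the chosen balls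
    -- provides; for `N = 0` there is no ball to bound.
    have hpos : μHE[k] (F 0) ≠ 0 ∨ N = 0 := by
      rcases Nat.eq_zero_or_pos N with h | h
      · exact Or.inr h
      · refine Or.inl (ne_of_gt ?_)
        exact (zero_le.trans_lt (hv ⟨0, h⟩)).trans_le ((measure_mono (hyS _)).trans hvol)
    have htile : ∀ i, ∀ z ∈ Metric.ball (y i) (r i), ∀ m : ℤ, z ∈ F m →
        |m - (a + (2 * K + 1) * (i : ℕ))| ≤ K := by
      intro i z hz m hm
      refine hK _ _ z hm (x i) (hx i).2 ?_
      have e1 := hX.radius_le hx₀ (hpos.resolve_right (by have := i.2; omega))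
        ((measure_mono (hyS i)).trans hvol)
      have e2 := dist_triangle_right z (x i) (y i)
      have e3 := Metric.mem_ball.1 hz
      have e4 := Metric.mem_ball.1 (hxy i)
      linarith
    have hpd : Pairwise fun i j => Disjoint (Metric.ball (y i) (r i)) (Metric.ball (y j) (r j)) := by
      intro i j hij
      rw [Set.disjoint_left]
      intro z hzi hzj
      obtain ⟨m, hm⟩ := hX.exists_mem_tile z
      have e1 := htile i z hzi m hm
      have e2 := htile j z hzj m hm
      refine hij (Fin.ext ?_)
      rw [abs_le] at e1 e2
      by_contra hne
      rcases lt_or_gt_of_ne hne with h | h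
      · have : ((i : ℕ) : ℤ) + 1 ≤ (j : ℕ) := by exact_mod_cast h
        nlinarith [e1.1, e1.2, e2.1, e2.2]
      · have : ((j : ℕ) : ℤ) + 1 ≤ (i : ℕ) := by exact_mod_cast h
        nlinarith [e1.1, e1.2, e2.1, e2.2]
    have hsum : (N : ℝ≥0∞) * ENNReal.ofReal ε ≤ μHE[k] (F 0) := by
      calc (N : ℝ≥0∞) * ENNReal.ofReal ε = ∑ _i : Fin N, ENNReal.ofReal ε := by simp
        _ ≤ ∑ i : Fin N, μHE[k] (Metric.ball (y i) (r i)) :=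
            Finset.sum_le_sum fun i _ => (hv i).le
        _ = μHE[k] (⋃ i, Metric.ball (y i) (r i)) := by
            rw [measure_iUnion hpd fun _ => Metric.isOpen_ball.measurableSet, tsum_fintype]
        _ ≤ μHE[k] S := measure_mono (iUnion_subset hyS)
        _ ≤ _ := hvol
    have h3 := ENNReal.toReal_mono hX.volume_finite.ne hsum
    rw [ENNReal.toReal_mul, ENNReal.toReal_natCast, ENNReal.toReal_ofReal hε.le] at h3
    linarith
  intro a b ha hb
  push_cast
  rw [abs_le]
  have h1 := key a b ha hb
  have h2 := key b a hb ha
  constructor <;> linarith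

end IsPeriodic

end Tiling

/-! ### Images of the core under equivariant diffeomorphisms. -/

section Core

variable {k : ℕ} {X : Type*} [MetricSpace X]
    [ChartedSpace (EuclideanSpace ℝ (Fin k)) X]
    [RiemannianBundle (fun x : X => TangentSpace (𝓡 k) x)]
    [MeasurableSpace X] [BorelSpace X]
    {ι : X → EuclideanSpace ℝ (Fin (k + 1))} {τ : Equiv.Perm X} {F : ℤ → Set X}

omit [MetricSpace X] [ChartedSpace (EuclideanSpace ℝ (Fin k)) X]
  [RiemannianBundle (fun x : X => TangentSpace (𝓡 k) x)] [MeasurableSpace X] [BorelSpace X] in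
theorem apply_zpow_apply {g : Equiv.Perm X} (hg : ∀ x, g (τ x) = τ (g x)) (n : ℤ) (x : X) :
    g ((τ ^ n) x) = (τ ^ n) (g x) := by
  have h : Commute g τ := Equiv.ext hg
  exact Equiv.congr_fun (h.zpow_right n) x

theorem IsPeriodic.disjoint_translates_image (hX : IsPeriodic ι τ F) {g : Equiv.Perm X}
    (hg : ∀ x, g (τ x) = τ (g x)) {U : Set X} (hU : U ⊆ F 0) :
    Pairwise fun m n : ℤ => Disjoint ((τ ^ m) '' (g '' U)) ((τ ^ n) '' (g '' U)) := by
  intro m n hmn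
  have h : ∀ n : ℤ, (τ ^ n) '' (g '' U) ⊆ g '' F n := by
    rintro n _ ⟨_, ⟨x, hx, rfl⟩, rfl⟩
    rw [← apply_zpow_apply hg, ← hX.translate n]
    exact ⟨_, ⟨x, hU hx, rfl⟩, rfl⟩
  exact ((disjoint_image_iff g.injective).2 (hX.disjoint hmn)).mono (h m) (h n)

omit [RiemannianBundle (fun x : X => TangentSpace (𝓡 k) x)] in
/-- The image of the core is a union of balls of volume greater than `ε`. -/
theorem exists_ball_subset_image {U : Set X} (hU : IsOpen U) (hb : HasSmoothBoundary k U)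
    {F₀ : Set X} {h₀ : X → ℝ} {B ε : ℝ} {g : Equiv.Perm X} (hg : IsDiffeo k g)
    (ha : IsAdmissible k F₀ U h₀ B ε g) {x : X} (hx : x ∈ g '' U) :
    ∃ y r, x ∈ Metric.ball y r ∧ Metric.ball y r ⊆ g '' U ∧
      ENNReal.ofReal ε < μHE[k] (Metric.ball y r) := by
  have hopen : IsOpen (g '' U) := hg.homeomorph.isOpenMap U hU
  -- Being the interior of one's closure passes through the homeomorphism `g`; hence a ball with
  -- closure in `closure (g '' U)` lies in `g '' U` itself.
  have hreg : interior (closure (g '' U)) = g '' U := by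
    have h1 := hg.homeomorph.image_interior (closure U)
    rw [hg.homeomorph.image_closure, hb.interior_closure hU] at h1
    exact h1.symm
  have h1 := ha.ball_condition.trans_le (iInf₂_le x (by rwa [hopen.interior_eq]))
  obtain ⟨v, ⟨y, r, hxy, hcl, rfl⟩, hv⟩ := lt_sSup_iff.1 h1
  refine ⟨y, r, hxy, ?_, hv⟩
  rw [← hreg]
  exact interior_maximal (subset_closure.trans hcl) Metric.isOpen_ball

/-- The image of the core meets some translate of the core. -/
theorem exists_apply_eq_zpow_apply (hX : IsPeriodic ι τ F) {U : Set X} {ε : ℝ}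
    (hU : IsCore k (F 0) U ε) {h₀ : X → ℝ} {B : ℝ} {g : Equiv.Perm X}
    (hg : g ∈ equivariantDiffeos k τ) (ha : IsAdmissible k (F 0) U h₀ B ε g) :
    ∃ u ∈ U, ∃ v ∈ U, ∃ n : ℤ, g u = (τ ^ n) v := by
  by_contra! hne
  obtain ⟨u, hu⟩ := hU.connected.nonempty
  obtain ⟨y, r, -, hyr, hv⟩ :=
    exists_ball_subset_image hU.isOpen hU.smoothBoundary hg.1 ha (mem_image_of_mem g hu)
  have hopen : IsOpen (g '' U) := hg.1.homeomorph.isOpenMap U hU.isOpen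
  have h1 := measure_inter_iUnion_translates_le hX.measure_zpow_image
    (hX.measurableSet_zpow_image hopen.measurableSet)
    (hX.disjoint_translates_image hg.2 hU.subset) (hX.measurable.diff hU.isOpen.measurableSet)
  -- An image missing every translate of `U` lies over the leftover `F 0 \ U`, so its volume is at
  -- most `ε`, yet it contains a ball of larger volume.
  have h2 : g '' U ⊆ g '' U ∩ ⋃ n : ℤ, (τ ^ n) '' (F 0 \ U) := by
    rintro _ ⟨w, hw, rfl⟩
    refine ⟨⟨w, hw, rfl⟩, ?_⟩
    obtain ⟨n, hn⟩ := hX.exists_mem_tile (g w)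
    rw [← hX.translate n] at hn
    obtain ⟨v, hv, hvw⟩ := hn
    exact mem_iUnion.2 ⟨n, v, ⟨hv, fun hvU => hne w hw v hvU n hvw.symm⟩, hvw⟩
  exact absurd (((measure_mono (hyr.trans h2)).trans h1).trans hU.volume_diff) (not_le.2 hv)

end Core

end PeriodicHypersurface

/-! ### The main theorem. -/

theorem mainTheorem4 {k : ℕ} {X : Type*} [MetricSpace X]
    [ChartedSpace (EuclideanSpace ℝ (Fin k)) X] [IsManifold (𝓡 k) ∞ X]
    [RiemannianBundle (fun x : X => TangentSpace (𝓡 k) x)]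
    [IsContMDiffRiemannianBundle (𝓡 k) ∞ (EuclideanSpace ℝ (Fin k))
      (fun x : X => TangentSpace (𝓡 k) x)]
    [IsRiemannianManifold (𝓡 k) X] [MeasurableSpace X] [BorelSpace X]
    (ι : X → EuclideanSpace ℝ (Fin (k + 1))) (τ : Equiv.Perm X) (F : ℤ → Set X)
    (hX : PeriodicHypersurface.IsPeriodic ι τ F)
    (h₀ : X → ℝ) (h₀_smooth : ContMDiff (𝓡 k) 𝓘(ℝ, ℝ) ∞ h₀) (h₀_nonneg : ∀ x, 0 ≤ h₀ x)
    (x₀ : X) (h : X → ℝ) (h_eq : h = PeriodicHypersurface.height k F h₀ x₀)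
    (h_triple : PeriodicHypersurface.IsTriple h τ F)
    (ε : ℝ) (hε : 0 < ε) :
    ∃ C₀ : ℝ, ∀ U : Set X, x₀ ∈ U → PeriodicHypersurface.IsCore k (F 0) U ε →
      ∀ (B : ℝ) (G' : Set (Equiv.Perm X)),
        G' ⊆ PeriodicHypersurface.equivariantDiffeos k τ →
        (∀ g ∈ G', PeriodicHypersurface.IsAdmissible k (F 0) U h₀ B ε g) →
      ∀ G : Subgroup (Equiv.Perm X),
        Maximal (fun H : Subgroup (Equiv.Perm X) => (H : Set (Equiv.Perm X)) ⊆ G') G →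
        τ ∈ G →
        (∀ g ∈ G, ∃ r : ℝ, h '' (g '' U) ⊆ Icc r (r + C₀)) ∧
        PeriodicHypersurface.IsQuasimorphism
          (fun g : G => h ((g : Equiv.Perm X) x₀) - h x₀) ∧
        ∃ μh : G → ℝ,
          PeriodicHypersurface.IsHomogenization
            (fun g : G => h ((g : Equiv.Perm X) x₀) - h x₀) μh ∧
          PeriodicHypersurface.IsQuasimorphism μh ∧
          PeriodicHypersurface.IsHomogeneous μh ∧
          μh ≠ 0 := by
  subst h_eq
  by_cases hx₀ : x₀ ∈ F 0
  swap
  -- If `x₀ ∉ F 0`, no admissible `U` exists and any constant serves.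
  · exact ⟨0, fun U hxU hU => absurd (hU.subset hxU) hx₀⟩
  obtain ⟨M, hM⟩ := hX.abs_sub_le_of_isTriple h_triple
  obtain ⟨C, hC⟩ := hX.exists_tile_range_le h₀_smooth.continuous hx₀ h_triple hε
  set h := PeriodicHypersurface.height k F h₀ x₀
  have hshift : ∀ (n : ℤ) (x : X), |h ((τ ^ n) x) - h x - n| ≤ 2 * M := by
    intro n x
    obtain ⟨m, hm⟩ := hX.exists_mem_tile x
    have h1 := hM m x hm
    have h2 := hM _ _ (hX.zpow_apply_mem n hm)
    push_cast at h2
    rw [abs_le] at *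
    constructor <;> linarith [h1.1, h1.2, h2.1, h2.2]
  refine ⟨2 * (2 * M + C), fun U hxU hU B G' hG' hadm G hG hτ => ?_⟩
  have hGG' : ∀ g ∈ G, g ∈ G' := fun g hg => hG.prop hg
  -- Two conversions from height to index cost `M` each, and `C` bounds the index range of `g(U)`.
  have hosc : ∀ g ∈ G, ∀ u ∈ U, ∀ v ∈ U, |h (g u) - h (g v)| ≤ 2 * M + C := by
    intro g hg u hu v hv
    have hgd := hG' (hGG' g hg)
    obtain ⟨m, hm⟩ := hX.exists_mem_tile (g u)
    obtain ⟨n, hn⟩ := hX.exists_mem_tile (g v)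
    have h1 := hC (g '' U) (hgd.1.homeomorph.isOpenMap U hU.isOpen)
      (hU.connected.isPreconnected.image g hgd.1.homeomorph.continuous.continuousOn)
      (hX.disjoint_translates_image hgd.2 hU.subset)
      (fun x hx => PeriodicHypersurface.exists_ball_subset_image hU.isOpen hU.smoothBoundary hgd.1
        (hadm g (hGG' g hg)) hx)
      m n ⟨_, ⟨u, hu, rfl⟩, hm⟩ ⟨_, ⟨v, hv, rfl⟩, hn⟩
    have h1' : |(m : ℝ) - n| ≤ C := by exact_mod_cast h1
    have h2 := hM m _ hm
    have h3 := hM n _ hn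
    rw [abs_le] at *
    constructor <;> linarith [h1'.1, h1'.2, h2.1, h2.2, h3.1, h3.2]
  have hquasi : PeriodicHypersurface.IsQuasimorphism
      (fun g : G => h ((g : Equiv.Perm X) x₀) - h x₀) := by
    -- Four oscillation estimates, for `a * b`, `a`, `b` and `1`, and two shifts by `τ ^ n`, each
    -- with error `2 * M`.
    refine ⟨4 * (2 * M + C) + 4 * M, fun a b => ?_⟩
    obtain ⟨u, hu, v, hv, n, huv⟩ := PeriodicHypersurface.exists_apply_eq_zpow_apply hX hU
      (hG' (hGG' b b.2)) (hadm b (hGG' b b.2))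
    have h1 := hosc (a * b) (a * b).2 x₀ hxU u hu
    have h2 := hosc a a.2 v hv x₀ hxU
    have h3 := hosc b b.2 x₀ hxU u hu
    have h4 := hosc 1 G.one_mem v hv x₀ hxU
    have h5 := hshift n ((a : Equiv.Perm X) v)
    have h6 := hshift n v
    rw [← PeriodicHypersurface.apply_zpow_apply (hG' (hGG' a a.2)).2, ← huv] at h5
    rw [← huv] at h6
    simp only [Subgroup.coe_mul, Equiv.Perm.coe_mul, Function.comp_apply, Equiv.Perm.coe_one,
      id_eq] at *
    rw [abs_le] at *
    constructor <;>
      linarith [h1.1, h1.2, h2.1, h2.2, h3.1, h3.2, h4.1, h4.2, h5.1, h5.2, h6.1, h6.2]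
  refine ⟨fun g hg => ⟨h (g x₀) - (2 * M + C), ?_⟩, hquasi, ?_⟩
  · rintro _ ⟨_, ⟨u, hu, rfl⟩, rfl⟩
    have h1 := hosc g hg u hu x₀ hxU
    rw [abs_le] at h1
    constructor <;> linarith [h1.1, h1.2]
  obtain ⟨μh, hμh⟩ := hquasi.exists_isHomogenization
  refine ⟨μh, hμh, hμh.isQuasimorphism hquasi, hμh.isHomogeneous hquasi, fun h0 => ?_⟩
  have hlim := hμh ⟨τ, hτ⟩
  -- The translation `τ` raises height by `1` per step up to a bounded error, so `μh` equals `1`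
  -- there.
  have h1 : Tendsto (fun n : ℕ => (h ((τ ^ n) x₀) - h x₀) / (n : ℝ)) atTop (𝓝 1) := by
    rw [tendsto_iff_norm_sub_tendsto_zero]
    refine squeeze_zero' (Eventually.of_forall fun _ => norm_nonneg _) ?_
      (tendsto_const_div_atTop_nhds_zero_nat (2 * M))
    filter_upwards [eventually_gt_atTop 0] with n hn
    have hn' : (0 : ℝ) < n := by exact_mod_cast hn
    have h2 := hshift n x₀
    rw [zpow_natCast, Int.cast_natCast] at h2
    rw [div_sub_one hn'.ne', Real.norm_eq_abs, abs_div, abs_of_pos hn']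
    gcongr
  have h2 := tendsto_nhds_unique hlim h1
  rw [h0] at h2
  exact zero_ne_one h2
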